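/- Notation. For a real polynomial $p$ put $\psi_p(t)=e^{2\pi i p(t)}$ $(t\in\mathbb R)$, a continuous map from $\mathbb R$ to the circle group $\mathbb T$. For $\varepsilon>0$ let $\mathcal V_\varepsilon=\{e^{2\pi i t}: t\in\mathbb R,\ |t|<\varepsilon\}\subseteq\mathbb T$. Let $\lambda$ be Lebesgue measure on $\mathbb R$. For a set $F$ of continuous maps $\mathbb R\to\mathbb T$ and $a\in\mathbb R$ put $$N^{\vartriangleleft}(F,\varepsilon,a)=\{t\in\mathbb R:\ \phi(t)\in\phi(a)\cdot\mathcal V_\varepsilon\ \text{ for all }\phi\in F\}.$$ For $I\subseteq\mathbb R$, let $\mathfrak P_{I,n,\varepsilon}$ be the collection of all sets $F$ of exactly $n$ continuous maps $\mathbb R\to\mathbb T$ such that $\lambda(N^{\vartriangleleft}(F,\varepsilon,a)\cap I)\ge\varepsilon^n\lambda(I)$ for all $a\in\mathbb R$. Polynomials $p_1,\dots,p_n\in\mathbb R[x]$ are strongly linearly independent over $\mathbb Q$ if $\sum_{j=1}^n h_jp_j$ is nonconstant for every nonzero $(h_1,\dots,h_n)\in\mathbb Z^n$. Theorem. Let $n\ge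 1$ and let $F=\{\psi_{p_1},\dots,\psi_{p_n}\}$, where $p_1,\dots,p_n\in\mathbb R[x]$ are strongly linearly independent over $\mathbb Q$. For every $\gamma>0$ there is $L(F,\gamma)>0$ such that, for every interval $I\subseteq\mathbb R$ (bounded or not) with $\lambda(I)\ge L(F,\gamma)$, every $a\in\mathbb R$ and every $\delta>0$ with $0<(2\delta)^n-\gamma\le 1$, $$\lambda\left(N^{\vartriangleleft}(F,\delta,a)\cap I\right)\ \ge\ \left((2\delta)^n-\gamma\right)\lambda(I).$$ (The upper bound $(2\delta)^n-\gamma\le1$ holds automatically when $\delta\le\frac12$.) In particular, for every $\delta$ with $0<\delta\le 1$ and every interval $I\subseteq\mathbb R$ with $\lambda(I)\ge L(F,\delta^n(2^n-1))$, one has $F\in\mathfrak P_{I,n,\delta}$. -/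

import Mathlib

open Polynomial MeasureTheory
open scoped Pointwise

/-- The phase function `ψ_p(t) = e^{2πi p(t)}` of a real polynomial `p`, as a continuous map from
the real line to the circle group. -/
noncomputable def phase (p : ℝ[X]) : C(ℝ, Circle) where
  toFun t := Circle.exp (2 * Real.pi * p.eval t)
  continuous_toFun := by fun_prop

/-- The open ball of radius `ε` about `1` in the circle group, for the angular distance:
`𝒱_ε = {e^{2πit} : |t| < ε}`. -/
def circleBall (ε : ℝ) : Set Circle :=
  {z | ∃ t : ℝ, |t| < ε ∧ z = Circle.exp (2 * Real.pi * t)}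

/-- `N^◁(Δ, ε, a) = {t ∈ G : φ(t) ∈ φ(a) · 𝒱_ε for all φ ∈ Δ}`. -/
def matchSet {G : Type*} [TopologicalSpace G] (Δ : Set C(G, Circle)) (ε : ℝ) (a : G) : Set G :=
  {t | ∀ φ ∈ Δ, φ t ∈ φ a • circleBall ε}

/-- `𝔓_{I,n,ε}`, with `μ` the Haar measure of `G`: the sets `F` of exactly `n` continuous maps
from `G` to the circle such that `μ(N^◁(F, ε, a) ∩ I) ≥ ε^n μ(I)` for all `a ∈ G`. -/
def matchFamilies {G : Type*} [TopologicalSpace G] [MeasurableSpace G] (μ : Measure G)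
    (I : Set G) (n : ℕ) (ε : ℝ) : Set (Set C(G, Circle)) :=
  {F | F.encard = n ∧
    ∀ a : G, ENNReal.ofReal (ε ^ n) * μ I ≤ μ (matchSet F ε a ∩ I)}

/-- The polynomials `p_1, …, p_n` are strongly linearly independent over `ℚ`: no nonzero integer
combination of them is a constant polynomial. -/
def StronglyLinearIndependent {n : ℕ} (p : Fin n → ℝ[X]) : Prop :=
  ∀ h : Fin n → ℤ, h ≠ 0 → ∀ c : ℝ, ∑ j, h j • p j ≠ C c

/-! This is Weyl equidistribution, uniform in the interval and the base point. For nonzero integer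
`h`, the function `∑ j, h j • p j` is a nonconstant polynomial, so its exponential integral is
bounded over all intervals (`exists_norm_integral_cexp_le`): integrate by parts and use that the
reciprocal of the derivative is eventually bounded and monotone. Fourier density on the torus then
gives convergence of averages of continuous functions along the curve `(p_1, …, p_n)`. Translating
the test function only multiplies characters by unimodular constants, so the rate does not depend on
`a`.

The match set of `a` is the set of times when the curve lies in a cube of side `2δ` about its
position at `a`. A continuous minorant of that cube loses little mass, and a finite grid of radii
makes the threshold independent of `δ`. -/

open Filter Topology

/-! ### Exponential integrals with polynomial phase -/

/-- A real polynomial is eventually of constant sign at `+∞`. -/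
theorem Polynomial.eventually_nonneg_or_eventually_nonpos (s : ℝ[X]) :
    (∀ᶠ t in atTop, 0 ≤ s.eval t) ∨ (∀ᶠ t in atTop, s.eval t ≤ 0) := by
  rcases le_or_gt s.degree 0 with hd | hd
  · rw [eq_C_of_degree_le_zero hd]
    simp only [eval_C]
    rcases le_total 0 (s.coeff 0) with h | h
    · exact Or.inl (Eventually.of_forall fun _ => h)
    · exact Or.inr (Eventually.of_forall fun _ => h)
  · rcases le_total 0 s.leadingCoeff with h | h
    · exact Or.inl ((s.tendsto_atTop_of_leadingCoeff_nonneg hd h).eventually_ge_atTop 0)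
    · exact Or.inr ((s.tendsto_atBot_of_leadingCoeff_nonpos hd h).eventually_le_atBot 0)

/-- The reciprocal of a nonzero real polynomial is bounded near `+∞`. -/
theorem Polynomial.exists_eventually_one_le_mul_abs_eval {r : ℝ[X]} (hr : r ≠ 0) :
    ∃ C : ℝ, 0 < C ∧ ∀ᶠ t in atTop, 1 ≤ C * |r.eval t| := by
  have h := isBigO_atTop_of_degree_le (1 : ℝ[X]) r
    (by rw [degree_one]; exact zero_le_degree_iff.2 hr)
  obtain ⟨C, hC, h⟩ := h.exists_pos
  refine ⟨C, hC, h.bound.mono fun t ht => ?_⟩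
  simpa using ht

theorem continuous_cexp_polynomial (q : ℝ[X]) :
    Continuous fun t : ℝ => Complex.exp (2 * Real.pi * Complex.I * (q.eval t : ℝ)) := by
  fun_prop

/-- Exponential integrals of a nonconstant polynomial phase are bounded along a half-line. -/
theorem Polynomial.exists_norm_integral_cexp_le_atTop {q : ℝ[X]} (hq : derivative q ≠ 0) :
    ∃ R K : ℝ, ∀ b, R ≤ b →
      ‖∫ t in R..b, Complex.exp (2 * Real.pi * Complex.I * (q.eval t : ℝ))‖ ≤ K := by
  set r := derivative q with hr
  obtain ⟨C, hC, hCr⟩ := exists_eventually_one_le_mul_abs_eval hq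
  obtain ⟨R₁, hR₁⟩ := eventually_atTop.1 hCr
  -- A constant sign of `r'` makes `1/r` monotone, so the integral of `|(1/r)'|` telescopes.
  obtain ⟨R₂, σ, hσ, hR₂⟩ : ∃ R₂ σ : ℝ, |σ| = 1 ∧
      ∀ t, R₂ ≤ t → |(derivative r).eval t| = σ * (derivative r).eval t := by
    rcases (derivative r).eventually_nonneg_or_eventually_nonpos with h | h
    · obtain ⟨R₂, h⟩ := eventually_atTop.1 h
      exact ⟨R₂, 1, by simp, fun t ht => by rw [abs_of_nonneg (h t ht), one_mul]⟩
    · obtain ⟨R₂, h⟩ := eventually_atTop.1 h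
      exact ⟨R₂, -1, by simp, fun t ht => by rw [abs_of_nonpos (h t ht), neg_one_mul]⟩
  set R := max R₁ R₂
  have hr0 : ∀ t, R ≤ t → r.eval t ≠ 0 := fun t ht h0 => by
    have := hR₁ t (le_trans (le_max_left _ _) ht)
    rw [h0] at this
    norm_num at this
  have hinv : ∀ t, R ≤ t → |(r.eval t)⁻¹| ≤ C := fun t ht => by
    have h1 := hR₁ t (le_trans (le_max_left _ _) ht)
    rw [abs_inv]
    exact inv_le_of_inv_le₀ hC (by rwa [inv_le_iff_one_le_mul₀' hC])
  set e : ℝ → ℂ := fun t => Complex.exp (2 * Real.pi * Complex.I * (q.eval t : ℝ)) with he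
  have hec : Continuous e := continuous_cexp_polynomial q
  have hen : ∀ t, ‖e t‖ = 1 := fun t => by
    have : (2 * Real.pi * Complex.I * (q.eval t : ℝ) : ℂ)
        = ((2 * Real.pi * q.eval t : ℝ) : ℂ) * Complex.I := by push_cast; ring
    rw [he]
    simp only [this, Complex.norm_exp_ofReal_mul_I]
  have hde : ∀ t, HasDerivAt e (2 * Real.pi * Complex.I * (r.eval t : ℝ) * e t) t := fun t => by
    have h1 : HasDerivAt (fun t : ℝ => ((q.eval t : ℝ) : ℂ)) ((r.eval t : ℝ) : ℂ) t :=
      (q.hasDerivAt t).ofReal_comp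
    have h2 := (h1.const_mul (2 * Real.pi * Complex.I : ℂ)).cexp
    convert h2 using 1
    rw [he]; ring
  have hpi : (2 * Real.pi * Complex.I : ℂ) ≠ 0 := Complex.two_pi_I_ne_zero
  have hnpi : ‖(2 * Real.pi * Complex.I : ℂ)⁻¹‖ ≤ 1 := by
    rw [norm_inv]
    refine inv_le_one_of_one_le₀ ?_
    simp only [norm_mul, Complex.norm_real, Complex.norm_I, Complex.norm_ofNat, Real.norm_eq_abs,
      abs_of_pos Real.pi_pos]
    linarith [Real.pi_gt_three]
  -- the primitive `e / (2πi r)` up to the error `e · (1/r)' / (2πi)`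
  set g : ℝ → ℝ := fun t => -(derivative r).eval t / (r.eval t) ^ 2 with hg
  have hdinv : ∀ t, R ≤ t → HasDerivAt (fun t => (r.eval t)⁻¹) (g t) t := fun t ht =>
    (r.hasDerivAt t).fun_inv (hr0 t ht)
  have hdG : ∀ t, R ≤ t → HasDerivAt (fun t => (2 * Real.pi * Complex.I : ℂ)⁻¹ *
      (e t * (((r.eval t)⁻¹ : ℝ) : ℂ)))
      (e t + (2 * Real.pi * Complex.I : ℂ)⁻¹ * (e t * (g t : ℝ))) t := fun t ht => by
    have h := ((hde t).mul (hdinv t ht).ofReal_comp).const_mul (2 * Real.pi * Complex.I : ℂ)⁻¹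
    refine h.congr_deriv ?_
    have : ((r.eval t : ℝ) : ℂ) ≠ 0 := by exact_mod_cast hr0 t ht
    push_cast
    field_simp
  -- Two boundary terms cost `C` each, the variation of `1/r` costs `2 * C`.
  refine ⟨R, 4 * C, fun b hb => ?_⟩
  have hsub : ∀ t ∈ Set.uIcc R b, R ≤ t := fun t ht => by
    rw [Set.uIcc_of_le hb] at ht; exact ht.1
  have hgc : ContinuousOn g (Set.uIcc R b) := by
    refine ContinuousOn.div (by fun_prop) (by fun_prop) fun t ht => pow_ne_zero _ (hr0 t (hsub t ht))
  have hgec : ContinuousOn (fun t => (2 * Real.pi * Complex.I : ℂ)⁻¹ * (e t * (g t : ℝ)))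
      (Set.uIcc R b) :=
    continuousOn_const.mul (hec.continuousOn.mul (Complex.continuous_ofReal.comp_continuousOn hgc))
  have hftc := intervalIntegral.integral_eq_sub_of_hasDerivAt
    (fun t ht => hdG t (hsub t ht)) ((hec.continuousOn.add hgec).intervalIntegrable)
  rw [intervalIntegral.integral_add (hec.intervalIntegrable _ _) hgec.intervalIntegrable] at hftc
  have hftc' := intervalIntegral.integral_eq_sub_of_hasDerivAt
    (fun t ht => hdinv t (hsub t ht)) hgc.intervalIntegrable
  have hbd : ∀ t, R ≤ t → ‖(2 * Real.pi * Complex.I : ℂ)⁻¹ *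
      (e t * (((r.eval t)⁻¹ : ℝ) : ℂ))‖ ≤ C := fun t ht => by
    rw [norm_mul, norm_mul, hen, one_mul, Complex.norm_real, Real.norm_eq_abs]
    calc _ ≤ 1 * C := mul_le_mul hnpi (hinv t ht) (abs_nonneg _) zero_le_one
      _ = C := one_mul C
  have herr : ‖∫ t in R..b, (2 * Real.pi * Complex.I : ℂ)⁻¹ * (e t * (g t : ℝ))‖ ≤ 2 * C := by
    have h1 : ‖∫ t in R..b, (2 * Real.pi * Complex.I : ℂ)⁻¹ * (e t * (g t : ℝ))‖
        ≤ ∫ t in R..b, -σ * g t := by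
      refine intervalIntegral.norm_integral_le_of_norm_le hb ?_
        (continuousOn_const.mul hgc).intervalIntegrable
      refine Eventually.of_forall fun t ht => ?_
      rw [norm_mul, norm_mul, hen, one_mul, Complex.norm_real, Real.norm_eq_abs]
      have h2 : |g t| = -σ * g t := by
        rw [hg]
        simp only [abs_div, abs_neg, abs_pow, sq_abs]
        rw [hR₂ t (le_trans (le_max_right _ _) ht.1.le)]
        ring
      rw [← h2]
      exact mul_le_of_le_one_left (abs_nonneg _) hnpi
    refine h1.trans ?_
    rw [intervalIntegral.integral_const_mul, hftc']
    refine (le_abs_self _).trans ?_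
    rw [abs_mul, abs_neg, hσ, one_mul]
    refine (abs_sub _ _).trans ?_
    linarith [hinv R le_rfl, hinv b hb]
  have : ∫ t in R..b, e t = (2 * Real.pi * Complex.I : ℂ)⁻¹ * (e b * (((r.eval b)⁻¹ : ℝ) : ℂ))
      - (2 * Real.pi * Complex.I : ℂ)⁻¹ * (e R * (((r.eval R)⁻¹ : ℝ) : ℂ))
      - ∫ t in R..b, (2 * Real.pi * Complex.I : ℂ)⁻¹ * (e t * (g t : ℝ)) :=
    eq_sub_of_add_eq hftc
  rw [this]
  refine (norm_sub_le _ _).trans ?_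
  have := norm_sub_le ((2 * Real.pi * Complex.I : ℂ)⁻¹ * (e b * (((r.eval b)⁻¹ : ℝ) : ℂ)))
    ((2 * Real.pi * Complex.I : ℂ)⁻¹ * (e R * (((r.eval R)⁻¹ : ℝ) : ℂ)))
  linarith [hbd b hb, hbd R le_rfl]

/-- Exponential integrals of a nonconstant polynomial phase are bounded on `[0, ∞)`. -/
theorem Polynomial.exists_norm_integral_cexp_le_of_nonneg {q : ℝ[X]} (hq : derivative q ≠ 0) :
    ∃ K : ℝ, ∀ b, 0 ≤ b →
      ‖∫ t in (0 : ℝ)..b, Complex.exp (2 * Real.pi * Complex.I * (q.eval t : ℝ))‖ ≤ K := by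
  obtain ⟨R, K, h⟩ := exists_norm_integral_cexp_le_atTop hq
  have hint : ∀ a b : ℝ, IntervalIntegrable
      (fun t : ℝ => Complex.exp (2 * Real.pi * Complex.I * (q.eval t : ℝ))) volume a b :=
    fun a b => (continuous_cexp_polynomial q).intervalIntegrable a b
  have hcont : Continuous fun b =>
      ‖∫ t in (0 : ℝ)..b, Complex.exp (2 * Real.pi * Complex.I * (q.eval t : ℝ))‖ :=
    (intervalIntegral.continuous_primitive hint 0).norm
  obtain ⟨B, hB⟩ := (isCompact_Icc (a := (0 : ℝ)) (b := R)).bddAbove_image hcont.continuousOn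
  refine ⟨max B (‖∫ t in (0 : ℝ)..R,
    Complex.exp (2 * Real.pi * Complex.I * (q.eval t : ℝ))‖ + K), fun b hb => ?_⟩
  rcases le_total b R with hbR | hbR
  · exact (hB ⟨b, ⟨hb, hbR⟩, rfl⟩).trans (le_max_left _ _)
  · rw [← intervalIntegral.integral_add_adjacent_intervals (hint 0 R) (hint R b)]
    exact (norm_add_le _ _).trans ((add_le_add le_rfl (h b hbR)).trans (le_max_right _ _))

/-- Exponential integrals of a nonconstant polynomial phase are bounded uniformly in the interval. -/
theorem Polynomial.exists_norm_integral_cexp_le {q : ℝ[X]} (hq : ∀ c, q ≠ C c) :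
    ∃ K : ℝ, ∀ a b : ℝ,
      ‖∫ t in a..b, Complex.exp (2 * Real.pi * Complex.I * (q.eval t : ℝ))‖ ≤ K := by
  have hd : derivative q ≠ 0 := fun h => hq _ (eq_C_of_derivative_eq_zero h)
  -- Reflection reduces the negative half-line to the positive one.
  have hd' : derivative (q.comp (-X)) ≠ 0 := by
    intro h
    have h1 := eq_C_of_derivative_eq_zero h
    have h2 := congrArg (fun s : ℝ[X] => s.comp (-X)) h1
    simp only [comp_assoc, neg_comp, X_comp, neg_neg, comp_X, C_comp] at h2
    exact hq _ h2
  obtain ⟨K₁, h₁⟩ := exists_norm_integral_cexp_le_of_nonneg hd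
  obtain ⟨K₂, h₂⟩ := exists_norm_integral_cexp_le_of_nonneg hd'
  have hint : ∀ a b : ℝ, IntervalIntegrable
      (fun t : ℝ => Complex.exp (2 * Real.pi * Complex.I * (q.eval t : ℝ))) volume a b :=
    fun a b => (continuous_cexp_polynomial q).intervalIntegrable a b
  have h0 : ∀ b : ℝ, ‖∫ t in (0 : ℝ)..b,
      Complex.exp (2 * Real.pi * Complex.I * (q.eval t : ℝ))‖ ≤ max K₁ K₂ := fun b => by
    rcases le_total 0 b with hb | hb
    · exact (h₁ b hb).trans (le_max_left _ _)
    · have h := h₂ (-b) (by linarith)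
      simp only [eval_comp, eval_neg, eval_X] at h
      rw [intervalIntegral.integral_comp_neg
        (fun t : ℝ => Complex.exp (2 * Real.pi * Complex.I * (q.eval t : ℝ))), neg_neg, neg_zero,
        intervalIntegral.integral_symm, norm_neg] at h
      exact h.trans (le_max_right _ _)
  refine ⟨max K₁ K₂ + max K₁ K₂, fun a b => ?_⟩
  rw [← intervalIntegral.integral_interval_sub_left (hint 0 b) (hint 0 a)]
  exact (norm_sub_le _ _).trans (add_le_add (h0 b) (h0 a))

/-! ### Well-distribution of polynomial curves on the torus -/

/-- The curve `t ↦ (p_1(t), …, p_n(t))` on the torus. -/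
noncomputable def polynomialCurve {n : ℕ} (p : Fin n → ℝ[X]) (t : ℝ) : UnitAddTorus (Fin n) :=
  fun j => ((p j).eval t : ℝ)

theorem continuous_polynomialCurve {n : ℕ} (p : Fin n → ℝ[X]) :
    Continuous (polynomialCurve p) :=
  continuous_pi fun j => (AddCircle.continuous_mk' 1).comp (p j).continuous

theorem mFourier_apply_add {d : Type*} [Fintype d] (h : d → ℤ) (x y : UnitAddTorus d) :
    UnitAddTorus.mFourier h (x + y) = UnitAddTorus.mFourier h x * UnitAddTorus.mFourier h y := by
  simp only [UnitAddTorus.mFourier, ContinuousMap.coe_mk, Pi.add_apply, fourier_apply, smul_add,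
    AddCircle.toCircle_add, Circle.coe_mul, Finset.prod_mul_distrib]

theorem mFourier_polynomialCurve {n : ℕ} (p : Fin n → ℝ[X]) (h : Fin n → ℤ) (t : ℝ) :
    UnitAddTorus.mFourier h (polynomialCurve p t) =
      Complex.exp (2 * Real.pi * Complex.I * ((∑ j, h j • p j).eval t : ℝ)) := by
  simp only [UnitAddTorus.mFourier, ContinuousMap.coe_mk, polynomialCurve, fourier_coe_apply]
  rw [← Complex.exp_sum]
  congr 1
  simp only [eval_finsetSum, eval_smul, Complex.ofReal_sum, Finset.mul_sum]
  refine Finset.sum_congr rfl fun j _ => ?_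
  rw [zsmul_eq_mul]
  push_cast
  ring

/-- The Haar probability measure of the torus. -/
noncomputable def torusHaar (n : ℕ) : Measure (UnitAddTorus (Fin n)) :=
  Measure.pi fun _ => (AddCircle.haarAddCircle : Measure UnitAddCircle)

instance (n : ℕ) : IsProbabilityMeasure (torusHaar n) := by
  unfold torusHaar; infer_instance

theorem integral_mFourier_torusHaar {n : ℕ} {h : Fin n → ℤ} (hh : h ≠ 0) :
    ∫ x, UnitAddTorus.mFourier h x ∂(torusHaar n) = 0 := by
  obtain ⟨j, hj⟩ := Function.ne_iff.1 hh
  simp only [UnitAddTorus.mFourier, ContinuousMap.coe_mk, torusHaar]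
  rw [integral_fintype_prod_eq_prod (f := fun i (x : UnitAddCircle) => fourier (h i) x)]
  refine Finset.prod_eq_zero (Finset.mem_univ j) ?_
  have h1 := congrFun (fourierCoeff_fourier (T := 1) (h j)) 0
  rw [Pi.single_eq_of_ne (Ne.symm hj : (0 : ℤ) ≠ h j)] at h1
  simpa [fourierCoeff] using h1

theorem ContinuousMap.integrable_torusHaar {n : ℕ} {E : Type*} [NormedAddCommGroup E]
    (f : C(UnitAddTorus (Fin n), E)) : Integrable f (torusHaar n) :=
  f.continuous.integrable_of_hasCompactSupport (HasCompactSupport.of_compactSpace f)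

/-- Quantitative equidistribution of a polynomial curve tested on trigonometric polynomials. -/
theorem exists_norm_integral_polynomialCurve_sub_le {n : ℕ} {p : Fin n → ℝ[X]}
    (hp : StronglyLinearIndependent p) {f : C(UnitAddTorus (Fin n), ℂ)}
    (hf : f ∈ Submodule.span ℂ (Set.range (UnitAddTorus.mFourier (d := Fin n)))) :
    ∃ K : ℝ, ∀ a b y,
      ‖(∫ t in a..b, f (polynomialCurve p t + y)) - (b - a) * ∫ x, f x ∂(torusHaar n)‖ ≤ K := by
  have hint : ∀ (f : C(UnitAddTorus (Fin n), ℂ)) (a b : ℝ) (y), IntervalIntegrable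
      (fun t => f (polynomialCurve p t + y)) volume a b := fun f a b y =>
    (f.continuous.comp ((continuous_polynomialCurve p).add continuous_const)).intervalIntegrable _ _
  induction hf using Submodule.span_induction with
  | mem f hf =>
    obtain ⟨h, rfl⟩ := hf
    by_cases hh : h = 0
    · refine ⟨0, fun a b y => ?_⟩
      simp [hh, UnitAddTorus.mFourier_zero]
    -- Strong independence enters here: the phase attached to a nontrivial character is nonconstant.
    · obtain ⟨K, hK⟩ := exists_norm_integral_cexp_le (hp h hh)
      refine ⟨K, fun a b y => ?_⟩
      rw [integral_mFourier_torusHaar hh, mul_zero, sub_zero]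
      simp only [mFourier_apply_add, mFourier_polynomialCurve]
      rw [intervalIntegral.integral_mul_const, norm_mul]
      have h1 : ‖UnitAddTorus.mFourier h y‖ ≤ 1 :=
        ((UnitAddTorus.mFourier h).norm_coe_le_norm y).trans UnitAddTorus.mFourier_norm.le
      exact (mul_le_of_le_one_right (norm_nonneg _) h1).trans (hK a b)
  | zero => exact ⟨0, fun a b y => by simp⟩
  | add f g _ _ hf hg =>
    obtain ⟨K₁, h₁⟩ := hf
    obtain ⟨K₂, h₂⟩ := hg
    refine ⟨K₁ + K₂, fun a b y => ?_⟩
    simp only [ContinuousMap.add_apply]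
    rw [intervalIntegral.integral_add (hint f a b y) (hint g a b y),
      integral_add f.integrable_torusHaar g.integrable_torusHaar, mul_add, add_sub_add_comm]
    exact (norm_add_le _ _).trans (add_le_add (h₁ a b y) (h₂ a b y))
  | smul c f _ hf =>
    obtain ⟨K, hK⟩ := hf
    refine ⟨‖c‖ * K, fun a b y => ?_⟩
    simp only [ContinuousMap.smul_apply, smul_eq_mul]
    rw [intervalIntegral.integral_const_mul, integral_const_mul, mul_left_comm, ← mul_sub, norm_mul]
    exact mul_le_mul_of_nonneg_left (hK a b y) (norm_nonneg _)

/-- Well-distribution of a polynomial curve on the torus: averages of a continuous function along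
long intervals converge uniformly in the interval and in the translation. -/
theorem exists_norm_integral_polynomialCurve_sub_le_mul {n : ℕ} {p : Fin n → ℝ[X]}
    (hp : StronglyLinearIndependent p) (f : C(UnitAddTorus (Fin n), ℂ)) {ε : ℝ} (hε : 0 < ε) :
    ∃ L : ℝ, ∀ u T y, L ≤ T →
      ‖(∫ t in u..(u + T), f (polynomialCurve p t + y)) - T * ∫ x, f x ∂(torusHaar n)‖
        ≤ ε * T := by
  have hmem : f ∈ (Submodule.span ℂ
      (Set.range (UnitAddTorus.mFourier (d := Fin n)))).topologicalClosure := by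
    rw [UnitAddTorus.span_mFourier_closure_eq_top]; trivial
  obtain ⟨g, hg, hfg⟩ := Metric.mem_closure_iff.1 hmem (ε / 3) (by positivity)
  rw [dist_eq_norm] at hfg
  obtain ⟨K, hK⟩ := exists_norm_integral_polynomialCurve_sub_le hp hg
  -- The error splits in thirds: replacing `f` by `g` along the curve, the bounded discrepancy `K`
  -- of `g`, and replacing the mean of `g` by that of `f`.
  refine ⟨max 0 (3 * K / ε), fun u T y hT => ?_⟩
  have hT0 : 0 ≤ T := (le_max_left _ _).trans hT
  have hKT : K ≤ ε / 3 * T := by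
    have := (div_le_iff₀ hε).1 ((le_max_right _ _).trans hT)
    linarith
  have hint : ∀ (f : C(UnitAddTorus (Fin n), ℂ)) (a b : ℝ) (y), IntervalIntegrable
      (fun t => f (polynomialCurve p t + y)) volume a b := fun f a b y =>
    (f.continuous.comp ((continuous_polynomialCurve p).add continuous_const)).intervalIntegrable _ _
  have hpt : ∀ x, ‖f x - g x‖ ≤ ε / 3 := fun x =>
    ((f - g).norm_coe_le_norm x).trans hfg.le
  have h1 : ‖(∫ t in u..(u + T), f (polynomialCurve p t + y)) -
      ∫ t in u..(u + T), g (polynomialCurve p t + y)‖ ≤ ε / 3 * T := by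
    rw [← intervalIntegral.integral_sub (hint f _ _ y) (hint g _ _ y)]
    refine (intervalIntegral.norm_integral_le_of_norm_le_const fun t _ => hpt _).trans ?_
    rw [add_sub_cancel_left, abs_of_nonneg hT0]
  have h2 : ‖(T : ℂ) * (∫ x, g x ∂(torusHaar n)) - T * ∫ x, f x ∂(torusHaar n)‖ ≤ ε / 3 * T := by
    rw [← mul_sub, ← integral_sub g.integrable_torusHaar f.integrable_torusHaar, norm_mul,
      Complex.norm_real, Real.norm_of_nonneg hT0, mul_comm]
    refine mul_le_mul_of_nonneg_right ?_ hT0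
    refine (norm_integral_le_of_norm_le_const (C := ε / 3)
      (Eventually.of_forall fun x => by rw [norm_sub_rev]; exact hpt x)).trans ?_
    simp
  have h3 := hK u (u + T) y
  have e3 : ((u + T : ℝ) : ℂ) - u = T := by push_cast; ring
  rw [e3] at h3
  calc _ = ‖((∫ t in u..(u + T), f (polynomialCurve p t + y)) -
      ∫ t in u..(u + T), g (polynomialCurve p t + y)) +
      ((∫ t in u..(u + T), g (polynomialCurve p t + y)) - T * ∫ x, g x ∂(torusHaar n)) +
      ((T : ℂ) * (∫ x, g x ∂(torusHaar n)) - T * ∫ x, f x ∂(torusHaar n))‖ := by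
        congr 1; ring
    _ ≤ ε / 3 * T + ε / 3 * T + ε / 3 * T := norm_add₃_le.trans (by gcongr; exact h3.trans hKT)
    _ = ε * T := by ring

/-! ### From cubes in the torus to match sets -/

theorem haarAddCircle_closedBall (r : ℝ) :
    (AddCircle.haarAddCircle : Measure UnitAddCircle) (Metric.closedBall 0 r) =
      ENNReal.ofReal (min 1 (2 * r)) := by
  rw [← AddCircle.volume_closedBall (T := 1) (x := 0), AddCircle.volume_eq_smul_haarAddCircle]
  simp

/-- A continuous minorant of a cube in the torus whose integral is almost the measure. -/
theorem exists_continuous_minorant_cube (n : ℕ) {r s : ℝ} (hrs : r < s) :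
    ∃ f : C(UnitAddTorus (Fin n), ℝ), (∀ x, f x ∈ Set.Icc (0 : ℝ) 1) ∧
      (∀ x, f x ≠ 0 → ∀ j, ‖x j‖ < s) ∧
      (max 0 (min 1 (2 * r))) ^ n ≤ ∫ x, f x ∂(torusHaar n) := by
  set A : Set (UnitAddTorus (Fin n)) := Set.univ.pi fun _ => Metric.closedBall (0 : UnitAddCircle) r
  set B : Set (UnitAddTorus (Fin n)) := {x | ∃ j, s ≤ ‖x j‖}
  have hA : IsClosed A := isClosed_set_pi fun _ _ => Metric.isClosed_closedBall
  have hB : IsClosed B := by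
    have : B = ⋃ j, {x : UnitAddTorus (Fin n) | s ≤ ‖x j‖} := by ext; simp [B]
    rw [this]
    exact isClosed_iUnion_of_finite fun j => isClosed_le continuous_const
      (continuous_norm.comp (continuous_apply j))
  have hd : Disjoint B A := by
    rw [Set.disjoint_left]
    rintro x ⟨j, hj⟩ hx
    have := hx j (Set.mem_univ j)
    rw [mem_closedBall_zero_iff] at this
    linarith
  obtain ⟨f, h0, h1, h01⟩ := exists_continuous_zero_one_of_isClosed hB hA hd
  refine ⟨f, h01, fun x hx j => ?_, ?_⟩
  · by_contra hj
    exact hx (h0 ⟨j, not_lt.1 hj⟩)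
  · have hm : (torusHaar n).real A = (max 0 (min 1 (2 * r))) ^ n := by
      rw [measureReal_def, torusHaar, Measure.pi_pi]
      simp only [haarAddCircle_closedBall, Finset.prod_const, Finset.card_univ, Fintype.card_fin,
        ENNReal.toReal_pow, ENNReal.toReal_ofReal', max_comm]
    rw [← hm, ← integral_indicator_one hA.measurableSet]
    refine integral_mono ((integrable_const (1 : ℝ)).indicator hA.measurableSet)
      f.integrable_torusHaar fun x => ?_
    by_cases hx : x ∈ A
    · rw [Set.indicator_of_mem hx, h1 hx]
    · rw [Set.indicator_of_notMem hx]; exact (h01 x).1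

theorem circleBall_eq_univ {δ : ℝ} (hδ : 1 / 2 < δ) : circleBall δ = Set.univ := by
  refine Set.eq_univ_of_forall fun z => ⟨Complex.arg z / (2 * Real.pi), ?_, ?_⟩
  · refine lt_of_le_of_lt ?_ hδ
    rw [abs_div, abs_of_pos Real.two_pi_pos, div_le_iff₀ Real.two_pi_pos]
    linarith [Complex.abs_arg_le_pi z]
  · rw [mul_div_cancel₀ _ Real.two_pi_pos.ne', Circle.exp_arg]

theorem matchSet_eq_univ {G : Type*} [TopologicalSpace G] (Δ : Set C(G, Circle)) {δ : ℝ}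
    (hδ : 1 / 2 < δ) (a : G) : matchSet Δ δ a = Set.univ := by
  refine Set.eq_univ_of_forall fun t φ _ => ?_
  rw [circleBall_eq_univ hδ, Set.smul_set_univ]
  trivial

/-- Subtracting the nearest integer from `p_j(t) - p_j(a)` leaves the phase unchanged and realizes
the norm on the circle. -/
theorem mem_matchSet_range_phase {n : ℕ} {p : Fin n → ℝ[X]} {δ a t : ℝ}
    (h : ∀ j, ‖(polynomialCurve p t + -polynomialCurve p a) j‖ < δ) :
    t ∈ matchSet (Set.range fun j => phase (p j)) δ a := by
  rintro _ ⟨j, rfl⟩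
  set x : ℝ := (p j).eval t - (p j).eval a
  have hx : ‖(x : UnitAddCircle)‖ < δ := by
    have := h j
    rw [← sub_eq_add_neg] at this
    simpa [polynomialCurve, x] using this
  rw [UnitAddCircle.norm_eq] at hx
  refine Set.mem_smul_set.2 ⟨_, ⟨x - round x, hx, rfl⟩, ?_⟩
  simp only [phase, ContinuousMap.coe_mk, smul_eq_mul]
  rw [← Circle.exp_add, ← mul_add]
  have : (p j).eval t = ((p j).eval a + (x - round x)) + round x := by simp only [x]; ring
  rw [this, mul_add _ _ (round x : ℝ), Circle.exp_add, mul_comm (2 * Real.pi) (round x : ℝ),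
    Circle.exp_int_mul_two_pi, mul_one]

/-- A function with values in `[0, 1]` is at most the indicator of the set where it is nonzero. -/
theorem ofReal_integral_le_volume_matchSet {n : ℕ} {p : Fin n → ℝ[X]} {δ : ℝ}
    {f : C(UnitAddTorus (Fin n), ℝ)} (h01 : ∀ x, f x ∈ Set.Icc (0 : ℝ) 1)
    (hf : ∀ x, f x ≠ 0 → ∀ j, ‖x j‖ < δ) (a : ℝ) {u v : ℝ} (huv : u ≤ v) :
    ENNReal.ofReal (∫ t in u..v, f (polynomialCurve p t + -polynomialCurve p a)) ≤
      volume (matchSet (Set.range fun j => phase (p j)) δ a ∩ Set.Icc u v) := by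
  set g : ℝ → ℝ := fun t => f (polynomialCurve p t + -polynomialCurve p a) with hg
  have hgc : Continuous g :=
    f.continuous.comp ((continuous_polynomialCurve p).add continuous_const)
  set S : Set ℝ := {t | g t ≠ 0}
  have hS : MeasurableSet S := (isOpen_ne_fun hgc continuous_const).measurableSet
  have hsub : S ∩ Set.Ioc u v ⊆ matchSet (Set.range fun j => phase (p j)) δ a ∩ Set.Icc u v :=
    fun t ht => ⟨mem_matchSet_range_phase (hf _ ht.1), Set.Ioc_subset_Icc_self ht.2⟩
  refine le_trans ?_ (measure_mono hsub)
  refine ENNReal.ofReal_le_of_le_toReal ?_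
  rw [intervalIntegral.integral_of_le huv, ← Measure.restrict_apply hS, ← measureReal_def,
    ← integral_indicator_one hS]
  refine integral_mono (hgc.integrableOn_Ioc) ((integrable_const (1 : ℝ)).indicator hS) fun t => ?_
  by_cases ht : t ∈ S
  · rw [Set.indicator_of_mem ht]; exact (h01 _).2
  · rw [Set.indicator_of_notMem ht]; exact (not_not.1 ht).le

/-! ### Density of match sets in long intervals -/

/-- The match sets of a strongly independent family have density at least `(2δ)^n - γ` in all
sufficiently long compact intervals. -/
theorem exists_ofReal_mul_le_volume_matchSet_inter_Icc {n : ℕ} {p : Fin n → ℝ[X]}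
    (hp : StronglyLinearIndependent p) {γ : ℝ} (hγ : 0 < γ) :
    ∃ L : ℝ, 0 < L ∧ ∀ u T a δ : ℝ, L ≤ T → 0 < δ → (2 * δ) ^ n - γ ≤ 1 →
      ENNReal.ofReal ((2 * δ) ^ n - γ) * ENNReal.ofReal T ≤
        volume (matchSet (Set.range fun j => phase (p j)) δ a ∩ Set.Icc u (u + T)) := by
  -- Mesh `1/M` of the grid of radii: rounding `δ` changes the side by at most `4/M`, hence the
  -- volume by at most `4n/M ≤ γ/2`.
  obtain ⟨M, hM⟩ := exists_nat_gt (max 0 (8 * n / γ))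
  have hM0 : (0 : ℝ) < M := (le_max_left _ _).trans_lt hM
  have hMn : 4 / M * n ≤ γ / 2 := by
    have := (div_lt_iff₀ hγ).1 ((le_max_right _ _).trans_lt hM)
    rw [div_mul_eq_mul_div, div_le_iff₀ hM0]
    linarith
  have hstep : ∀ j : ℕ, ((j : ℝ) - 1) / M < j / M := fun j => by gcongr; linarith
  choose f h01 hf hint using fun j : ℕ => exists_continuous_minorant_cube n (hstep j)
  choose L hL using fun j : ℕ => exists_norm_integral_polynomialCurve_sub_le_mul hp
    (⟨fun x => ((f j x : ℝ) : ℂ), by fun_prop⟩ : C(UnitAddTorus (Fin n), ℂ)) (half_pos hγ)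
  obtain ⟨B, hB⟩ := ((Finset.range (M + 1)).image L).bddAbove
  refine ⟨max 1 B, lt_max_of_lt_left one_pos, fun u T a δ hT hδ hle => ?_⟩
  have hT0 : 0 < T := one_pos.trans_le ((le_max_left _ _).trans hT)
  rcases lt_or_ge (1 / 2) δ with hδ2 | hδ2
  · rw [matchSet_eq_univ _ hδ2, Set.univ_inter, Real.volume_Icc, add_sub_cancel_left]
    exact mul_le_of_le_one_left zero_le (ENNReal.ofReal_le_one.2 hle)
  -- As `δ ≤ 1/2`, only the finitely many `j ≤ M` occur. For `j = 0` the inner radius is negative,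
  -- which the clamp `max 0` in the minorant's mass absorbs.
  set j := ⌊δ * M⌋₊ with hj
  have hjle : (j : ℝ) ≤ δ * M := Nat.floor_le (by positivity)
  have hjlt : δ * M < j + 1 := Nat.lt_floor_add_one _
  have hjδ : (j : ℝ) / M ≤ δ := (div_le_iff₀ hM0).2 hjle
  have hjM : j < M + 1 := by
    have : (j : ℝ) < M + 1 := by nlinarith
    exact_mod_cast this
  have hLT : L j ≤ T := (hB (Finset.mem_coe.2 (Finset.mem_image_of_mem L
    (Finset.mem_range.2 hjM)))).trans ((le_max_right _ _).trans hT)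
  refine le_trans ?_ (ofReal_integral_le_volume_matchSet (h01 j)
    (fun x hx i => (hf j x hx i).trans_le hjδ) a (by linarith : u ≤ u + T))
  rw [← ENNReal.ofReal_mul' hT0.le]
  refine ENNReal.ofReal_le_ofReal ?_
  have havg : |(∫ t in u..(u + T), f j (polynomialCurve p t + -polynomialCurve p a)) -
      T * ∫ x, f j x ∂(torusHaar n)| ≤ γ / 2 * T := by
    have h := hL j u T (-polynomialCurve p a) hLT
    simp only [ContinuousMap.coe_mk] at h
    rwa [intervalIntegral.integral_ofReal, integral_complex_ofReal, ← Complex.ofReal_mul,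
      ← Complex.ofReal_sub, Complex.norm_real, Real.norm_eq_abs] at h
  have hmass : (2 * δ) ^ n - γ / 2 ≤ ∫ x, f j x ∂(torusHaar n) := by
    refine le_trans ?_ (hint j)
    set y := max 0 (min 1 (2 * (((j : ℝ) - 1) / M)))
    have hr1 : ((j : ℝ) - 1) / M ≤ δ := (hstep j).le.trans hjδ
    have hr2 : δ - 2 / M ≤ ((j : ℝ) - 1) / M := by
      rw [le_div_iff₀ hM0, sub_mul, div_mul_cancel₀ _ hM0.ne']
      linarith
    have hy0 : 0 ≤ y := le_max_left _ _
    have hyx : y ≤ 2 * δ := max_le (by linarith) ((min_le_right _ _).trans (by linarith))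
    have hxy : 2 * δ - y ≤ 4 / M := by
      have h4 : (4 : ℝ) / M = 2 * (2 / M) := by ring
      have h5 : 0 < (2 : ℝ) / M := by positivity
      have : 2 * δ - 4 / M ≤ y := le_max_of_le_right (le_min (by linarith) (by linarith))
      linarith
    have hpow := (le_abs_self _).trans (abs_pow_sub_pow_le (2 * δ) y n)
    have hmax : max |2 * δ| |y| ^ (n - 1) ≤ 1 := by
      refine pow_le_one₀ (le_max_of_le_left (abs_nonneg _)) (max_le ?_ ?_)
      · rw [abs_of_pos (by linarith)]; linarith
      · rw [abs_of_nonneg hy0]; linarith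
    have : |2 * δ - y| * n * max |2 * δ| |y| ^ (n - 1) ≤ 4 / M * n := by
      refine (mul_le_of_le_one_right (by positivity) hmax).trans ?_
      rw [abs_of_nonneg (by linarith)]
      gcongr
    linarith
  have := (abs_le.1 havg).1
  nlinarith [mul_le_mul_of_nonneg_left hmass hT0.le]

/-- An order-connected set of reals contains compact intervals of any length below its measure. -/
theorem Set.OrdConnected.exists_Icc_subset_of_lt_volume {I : Set ℝ} (hI : I.OrdConnected) {T : ℝ}
    (hT : ENNReal.ofReal T < volume I) : ∃ u, Set.Icc u (u + T) ⊆ I := by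
  obtain ⟨K, hKI, hK, hTK⟩ := hI.measurableSet.exists_lt_isCompact hT
  have hne : K.Nonempty := by
    rw [Set.nonempty_iff_ne_empty]
    rintro rfl
    simp at hTK
  have h1 := hK.sInf_mem hne
  have h2 := hK.sSup_mem hne
  have hsub : K ⊆ Set.Icc (sInf K) (sSup K) := fun x hx =>
    ⟨csInf_le hK.bddBelow hx, le_csSup hK.bddAbove hx⟩
  have hlt := hTK.trans_le (measure_mono hsub)
  rw [Real.volume_Icc, ENNReal.ofReal_lt_ofReal_iff'] at hlt
  exact ⟨sInf K, (Set.Icc_subset_Icc le_rfl (by linarith [hlt.1])).trans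
    (hI.out (hKI h1) (hKI h2))⟩

theorem exists_ofReal_mul_le_volume_matchSet_inter {n : ℕ} {p : Fin n → ℝ[X]}
    (hp : StronglyLinearIndependent p) {γ : ℝ} (hγ : 0 < γ) :
    ∃ L : ℝ, 0 < L ∧ ∀ I : Set ℝ, I.OrdConnected → ENNReal.ofReal L ≤ volume I →
      ∀ a δ : ℝ, 0 < δ → (2 * δ) ^ n - γ ≤ 1 →
        ENNReal.ofReal ((2 * δ) ^ n - γ) * volume I ≤
          volume (matchSet (Set.range fun j => phase (p j)) δ a ∩ I) := by
  obtain ⟨L, hL0, hL⟩ := exists_ofReal_mul_le_volume_matchSet_inter_Icc hp hγ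
  -- The extra `1` gives a strict inequality, so that `I` contains a compact interval of length at
  -- least `L` even if `I` is not closed.
  refine ⟨L + 1, by linarith, fun I hI hLI a δ hδ hle => ?_⟩
  have hLI' : ENNReal.ofReal L < volume I :=
    ((ENNReal.ofReal_lt_ofReal_iff (by linarith)).2 (by linarith)).trans_le hLI
  -- Approximating `volume I` from below treats bounded and unbounded intervals together.
  refine ENNReal.mul_le_of_forall_lt fun c hc w hw => ?_
  set T := max L w.toReal
  have hw' : w ≠ ⊤ := hw.ne_top
  have hT : ENNReal.ofReal T < volume I := by
    rw [ENNReal.ofReal_max, ENNReal.ofReal_toReal hw']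
    exact max_lt hLI' hw
  obtain ⟨u, hu⟩ := hI.exists_Icc_subset_of_lt_volume hT
  calc c * w ≤ ENNReal.ofReal ((2 * δ) ^ n - γ) * w := by gcongr
    _ ≤ ENNReal.ofReal ((2 * δ) ^ n - γ) * ENNReal.ofReal T := by
        rw [ENNReal.ofReal_max, ENNReal.ofReal_toReal hw']
        gcongr
        exact le_max_right _ _
    _ ≤ _ := hL u T a δ (le_max_left _ _) hδ hle
    _ ≤ _ := measure_mono (Set.inter_subset_inter_right _ hu)

/-! ### Distinctness of the phases and conclusion -/

/-- If two phases agreed, the exponential of `p i - p j` would be identically `1`, with unbounded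
integrals, although this difference is nonconstant. -/
theorem StronglyLinearIndependent.phase_injective {n : ℕ} {p : Fin n → ℝ[X]}
    (hp : StronglyLinearIndependent p) : Function.Injective fun j => phase (p j) := by
  intro i j hij
  by_contra hne
  have hh : (Pi.single i 1 - Pi.single j 1 : Fin n → ℤ) ≠ 0 := fun h => by
    have := congrFun h i
    simp [hne] at this
  have hsum : ∑ k, (Pi.single i 1 - Pi.single j 1 : Fin n → ℤ) k • p k = p i - p j := by
    simp [Pi.single_apply, sub_smul, Finset.sum_sub_distrib, ite_smul]
  obtain ⟨K, hK⟩ := exists_norm_integral_cexp_le (q := p i - p j) fun c hc =>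
    hp _ hh c (hsum.trans hc)
  have hone : ∀ t : ℝ,
      Complex.exp (2 * Real.pi * Complex.I * ((p i - p j).eval t : ℝ)) = 1 := fun t => by
    have h1 : Circle.exp (2 * Real.pi * (p i).eval t) = Circle.exp (2 * Real.pi * (p j).eval t) :=
      DFunLike.congr_fun hij t
    have h2 : Circle.exp (2 * Real.pi * (p i).eval t - 2 * Real.pi * (p j).eval t) = 1 := by
      rw [Circle.exp_sub, h1, div_self']
    have h3 := congrArg (fun z : Circle => (z : ℂ)) h2
    simp only [Circle.coe_exp, Circle.coe_one] at h3
    rw [← h3, eval_sub]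
    congr 1
    push_cast
    ring
  have h := hK 0 (|K| + 1)
  simp only [hone, intervalIntegral.integral_const, sub_zero, Complex.real_smul, mul_one,
    Complex.norm_real, Real.norm_eq_abs] at h
  rw [abs_of_pos (by positivity)] at h
  linarith [le_abs_self K]

theorem mainTheorem7 {n : ℕ} (p : Fin n → ℝ[X]) (hp : StronglyLinearIndependent p)
    (F : Set C(ℝ, Circle)) (hF : F = Set.range (fun j => phase (p j))) :
    ∃ L : ℝ → ℝ,
      (∀ γ : ℝ, 0 < γ → 0 < L γ ∧
        ∀ I : Set ℝ, I.OrdConnected → ENNReal.ofReal (L γ) ≤ volume I →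
          ∀ a δ : ℝ, 0 < δ → 0 < (2 * δ) ^ n - γ → (2 * δ) ^ n - γ ≤ 1 →
            ENNReal.ofReal ((2 * δ) ^ n - γ) * volume I ≤ volume (matchSet F δ a ∩ I)) ∧
      (∀ δ : ℝ, 0 < δ → δ ≤ 1 →
        ∀ I : Set ℝ, I.OrdConnected → ENNReal.ofReal (L (δ ^ n * (2 ^ n - 1))) ≤ volume I →
          F ∈ matchFamilies volume I n δ) := by
  subst hF
  choose! L hL0 hL using fun (γ : ℝ) (hγ : 0 < γ) =>
    exists_ofReal_mul_le_volume_matchSet_inter hp hγ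
  refine ⟨L, fun γ hγ => ⟨hL0 γ hγ, fun I hI hLI a δ hδ _ hle => hL γ hγ I hI hLI a δ hδ hle⟩,
    fun δ hδ hδ1 I hI hLI => ⟨?_, fun a => ?_⟩⟩
  · rw [← Set.image_univ, hp.phase_injective.encard_image]
    simp
  -- For `n = 0` the value `δ ^ n * (2 ^ n - 1)` is `0`, so `L` gives nothing there; the match
  -- condition is vacuous.
  · rcases Nat.eq_zero_or_pos n with rfl | hn
    · have : matchSet (Set.range fun j => phase (p j)) δ a = Set.univ :=
        Set.eq_univ_of_forall fun t φ hφ => by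
          obtain ⟨j, _⟩ := hφ
          exact j.elim0
      rw [this]
      simp
    · have hγ : 0 < δ ^ n * (2 ^ n - 1) :=
        mul_pos (pow_pos hδ n) (sub_pos.2 (one_lt_pow₀ one_lt_two hn.ne'))
      have he : (2 * δ) ^ n - δ ^ n * (2 ^ n - 1) = δ ^ n := by rw [mul_pow]; ring
      have h := hL _ hγ I hI hLI a δ hδ (by rw [he]; exact pow_le_one₀ hδ.le hδ1)
      rwa [he] at h
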